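/- **Cost functions.** For a sequence $u=(u_i)_{i\ge 0}$ of reals let $\mathsf{Inf}(u)=\inf_i u_i$, $\mathsf{Sup}(u)=\sup_i u_i$, $\mathsf{LimInf}(u)=\liminf_i u_i$, $\mathsf{LimSup}(u)=\limsup_i u_i$, $\mathsf{Avg}(u)=\liminf_{n\to\infty}\frac1n\sum_{i=0}^n u_i$ and, for real $0<\lambda<1$, $\mathsf{DS}_\lambda(u)=\sum_{i\ge 0}\lambda^i u_i$. **Quantitative games.** A finite weighted arena is $A=(V_{\mathrm{Min}},V_{\mathrm{Max}},E,w,v_I)$ with a finite vertex set $V=V_{\mathrm{Min}}\uplus V_{\mathrm{Max}}$, edges $E\subseteq V^2$ such that every vertex has an outgoing edge, weights $w\colon E\to\mathbb N$ and an initial vertex $v_I\in V$. A play is an infinite path $v_0v_1\cdots$ with $v_0=v_I$. A strategy of a player $p\in\{\mathrm{Min},\mathrm{Max}\}$ maps each prefix $v_0\cdots v_k$ of a play with $v_k\in V_p$ to a successor of $v_k$; its outcomes are the plays that follow it at all vertices of $V_p$. A cost function $f$ induces $f_w(v_0v_1\cdots)=f(w(v_0,v_1)\,w(v_1,v_2)\cdots)$,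 and $$\overline{\mathbf{Val}}(A,f_w)=\inf_{\sigma_{\mathrm{Min}}}\ \sup_{\pi\text{ outcome of }\sigma_{\mathrm{Min}}} f_w(\pi),\qquad \underline{\mathbf{Val}}(A,f_w)=\sup_{\sigma_{\mathrm{Max}}}\ \inf_{\pi\text{ outcome of }\sigma_{\mathrm{Max}}} f_w(\pi).$$ **Sabotage games.** A quantitative sabotage game is $\mathcal G=(V,E,B,v_I,\delta_I,f)$ with a finite directed graph $(V,E)$ in which every vertex has an outgoing edge, $B\in\mathbb N$, $v_I\in V$, $\delta_I\in\Delta$ and one of the above cost functions $f$, where $\Delta$ is the set of $\delta\colon E\to\{0,\dots,B\}$ with $\sum_e\delta(e)\le B$. Write $\delta\triangleright\delta'$ if there are (possibly equal) $e_1,e_2\in E$ with $\delta'(e_1)\in\{\delta(e_1),\delta(e_1)-1\}$, $\delta'(e_2)\in\{\delta(e_2),\delta(e_2)+1\}$ and $\delta'(e)=\delta(e)$ for all other $e$. A play is an infinite sequence $v_0\delta_0v_1\delta_1\cdots$ with $v_0=v_I$, $\delta_0=\delta_I$, $(v_i,v_{i+1})\in E$ and $\delta_i\triangleright\delta_{i+1}$;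 its cost is $f(\delta_0(v_0,v_1)\,\delta_1(v_1,v_2)\cdots)$. A strategy $\rho$ of Runner maps each prefix $v_0\delta_0\cdots v_n\delta_n$ of a play to a successor of $v_n$; a strategy $\sigma$ of Saboteur maps each prefix $v_0\delta_0\cdots v_n\delta_nv_{n+1}$ to some $\delta'$ with $\delta_n\triangleright\delta'$. They determine a unique play $\pi_{\rho,\sigma}$. The superior value of $\mathcal G$ is $\sup_\sigma\inf_\rho f(\pi_{\rho,\sigma})$ and the inferior value is $\inf_\rho\sup_\sigma f(\pi_{\rho,\sigma})$. **Encoding.** $[\![\mathcal G]\!]$ is the quantitative game with $V_{\mathrm{Min}}=V\times\Delta$, $V_{\mathrm{Max}}=E\times\Delta$, initial vertex $(v_I,\delta_I)$, and, for each $e=(v,v')\in E$, edges $((v,\delta),(e,\delta))$ of weight $\delta(e)$ and, whenever $\delta\triangleright\delta'$, edges $((e,\delta),(v',\delta'))$, of weight $0$ if $f=\mathsf{DS}_\lambda$ and $\delta(e)$ otherwise; its cost function is $\mathsf{DS}_{\sqrt\lambda}$ if $f=\mathsf{DS}_\lambda$ and $f$ otherwise. **Proposition.** 1. For every finite weighted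 arena $A$ and every $f$ among $\mathsf{Inf},\mathsf{Sup},\mathsf{LimInf},\mathsf{LimSup},\mathsf{Avg},\mathsf{DS}_\lambda$ ($0<\lambda<1$), the upper and lower values coincide: $\overline{\mathbf{Val}}(A,f_w)=\underline{\mathbf{Val}}(A,f_w)$. 2. For every quantitative sabotage game $\mathcal G$ with one of these cost functions, the inferior and superior values of $\mathcal G$ are equal; moreover they agree with the upper and lower values of $[\![\mathcal G]\!]$. -/

import Mathlib

open Filter

noncomputable section

namespace Sabotage

/-- The six classical cost functions (the discounted sum is indexed by a factor in `(0, 1)`). -/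
inductive CostFunction where
  | Inf
  | Sup
  | LimInf
  | LimSup
  | Avg
  | DS (lam : ℝ) (pos : 0 < lam) (lt_one : lam < 1)

/-- The cost of an infinite sequence of reals. The real series in the case `DS` converges for
every bounded sequence, in particular for all sequences of weights of a game below. -/
def CostFunction.eval : CostFunction → (ℕ → ℝ) → EReal
  | .Inf, u => ⨅ i, (u i : EReal)
  | .Sup, u => ⨆ i, (u i : EReal)
  | .LimInf, u => liminf (fun i => (u i : EReal)) atTop
  | .LimSup, u => limsup (fun i => (u i : EReal)) atTop
  | .Avg, u =>
      liminf (fun n : ℕ => ((1 / (n : ℝ) * ∑ i ∈ Finset.range (n + 1), u i : ℝ) : EReal)) atTop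
  | .DS lam _ _, u => ((∑' i : ℕ, lam ^ i * u i : ℝ) : EReal)

/-! ### Quantitative two-player games -/

/-- The two players. -/
inductive Player where
  | Min
  | Max

/-- A weighted arena on the vertex set `V`: `owner` is the partition of `V` into the vertices of
`Min` and those of `Max`, and every vertex has an outgoing edge. -/
structure WeightedArena (V : Type*) where
  owner : V → Player
  edge : V → V → Prop
  weight : (v v' : V) → edge v v' → ℕ
  init : V
  exists_edge : ∀ v, ∃ v', edge v v'

namespace WeightedArena

variable {V : Type*} (G : WeightedArena V)

/-- Plays: infinite paths from the initial vertex. -/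
structure Play where
  vert : ℕ → V
  vert_zero : vert 0 = G.init
  edge : ∀ i, G.edge (vert i) (vert (i + 1))

/-- `G.Prefix v` is the type of prefixes of plays that end in `v`, i.e. (as there are no
deadlocks) of the finite paths from the initial vertex to `v`. -/
inductive Prefix : V → Type _
  | start {v : V} (h : v = G.init) : Prefix v
  | step {v v' : V} (p : Prefix v) (h : G.edge v v') : Prefix v'

variable {G}

/-- The prefix `v₀ ⋯ vₙ` of a play. -/
def Play.take (π : G.Play) : (n : ℕ) → G.Prefix (π.vert n)
  | 0 => .start π.vert_zero
  | n + 1 => .step (π.take n) (π.edge n)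

variable (G)

/-- A strategy of player `p`: it maps every prefix `v₀ ⋯ vₖ` belonging to `p` to a successor of
`vₖ`. -/
def Strategy (p : Player) : Type _ :=
  (v : V) → G.owner v = p → G.Prefix v → {v' : V // G.edge v v'}

variable {G}

/-- The outcomes of a strategy. -/
def Strategy.outcomes {p : Player} (σ : G.Strategy p) : Set G.Play :=
  {π | ∀ (k : ℕ) (h : G.owner (π.vert k) = p),
    π.vert (k + 1) = (σ (π.vert k) h (π.take k)).1}

variable (G)

/-- The value function on plays induced by a cost function and the weights of the arena. -/
def valueFunction (f : CostFunction) (π : G.Play) : EReal :=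
  f.eval fun i => (G.weight (π.vert i) (π.vert (i + 1)) (π.edge i) : ℝ)

variable {G}

/-- The value of a strategy of `Min` with respect to the value function `f`. -/
def Strategy.valueMin (σ : G.Strategy .Min) (f : G.Play → EReal) : EReal :=
  ⨆ π ∈ σ.outcomes, f π

/-- The value of a strategy of `Max` with respect to the value function `f`. -/
def Strategy.valueMax (σ : G.Strategy .Max) (f : G.Play → EReal) : EReal :=
  ⨅ π ∈ σ.outcomes, f π

variable (G)

/-- The upper value of the quantitative game `(G, f)`. -/
def upperValue (f : G.Play → EReal) : EReal :=
  ⨅ σ : G.Strategy .Min, σ.valueMin f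

/-- The lower value of the quantitative game `(G, f)`. -/
def lowerValue (f : G.Play → EReal) : EReal :=
  ⨆ σ : G.Strategy .Max, σ.valueMax f

end WeightedArena

/-! ### Quantitative sabotage games -/

/-- Distributions of the budget `B` on the finite set of edges `E`. -/
def Distribution {V : Type*} (E : Finset (V × V)) (B : ℕ) : Type _ :=
  {δ : E → Fin (B + 1) // ∑ e, (δ e : ℕ) ≤ B}

/-- The budget `δ(e)` on the edge `e`. -/
def Distribution.at {V : Type*} {E : Finset (V × V)} {B : ℕ} (δ : Distribution E B) (e : E) : ℕ :=
  (δ.1 e : ℕ)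

/-- `δ'` is a valid redistribution from `δ` (the edges `e₁`, `e₂` may coincide). -/
def Distribution.Redistr {V : Type*} {E : Finset (V × V)} {B : ℕ} (δ δ' : Distribution E B) :
    Prop :=
  ∃ e₁ e₂ : E, (δ'.at e₁ = δ.at e₁ ∨ δ'.at e₁ + 1 = δ.at e₁) ∧
    (δ'.at e₂ = δ.at e₂ ∨ δ'.at e₂ = δ.at e₂ + 1) ∧
    ∀ e : E, e ≠ e₁ → e ≠ e₂ → δ'.at e = δ.at e

/-- A quantitative sabotage game on the directed graph `(V, E)`. -/
structure SabotageGame (V : Type*) where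
  E : Finset (V × V)
  B : ℕ
  vI : V
  δI : Distribution E B
  f : CostFunction
  no_deadlock : ∀ v, ∃ v', (v, v') ∈ E

namespace SabotageGame

variable {V : Type*} (G : SabotageGame V)

/-- The budget distributions of the game. -/
abbrev Dist : Type _ := Distribution G.E G.B

/-- Plays `v₀ δ₀ v₁ δ₁ ⋯` of a sabotage game. -/
structure Play where
  vert : ℕ → V
  dist : ℕ → G.Dist
  vert_zero : vert 0 = G.vI
  dist_zero : dist 0 = G.δI
  edge : ∀ i, (vert i, vert (i + 1)) ∈ G.E
  redistr : ∀ i, (dist i).Redistr (dist (i + 1))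

/-- `G.Prefix v δ` is the type of prefixes `v₀ δ₀ ⋯ vₙ δₙ` of plays with `vₙ = v` and `δₙ = δ`. -/
inductive Prefix : V → G.Dist → Type _
  | start : Prefix G.vI G.δI
  | step {v v' : V} {δ δ' : G.Dist} (p : Prefix v δ) (hv : (v, v') ∈ G.E) (hδ : δ.Redistr δ') :
      Prefix v' δ'

/-- A strategy of Runner maps every prefix `v₀ δ₀ ⋯ vₙ δₙ` to a successor of `vₙ`. -/
def RunnerStrategy : Type _ :=
  (v : V) → (δ : G.Dist) → G.Prefix v δ → {v' : V // (v, v') ∈ G.E}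

/-- A strategy of Saboteur maps every prefix `v₀ δ₀ ⋯ vₙ δₙ vₙ₊₁` to a valid redistribution
from `δₙ`. -/
def SaboteurStrategy : Type _ :=
  (v : V) → (δ : G.Dist) → G.Prefix v δ → (v' : V) → (v, v') ∈ G.E →
    {δ' : G.Dist // δ.Redistr δ'}

/-- A position together with the prefix that leads to it. -/
structure State where
  v : V
  δ : G.Dist
  hist : G.Prefix v δ

variable {G}

/-- One round: Runner moves, then Saboteur redistributes. -/
def State.next (s : G.State) (ρ : G.RunnerStrategy) (σ : G.SaboteurStrategy) : G.State where
  v := (ρ s.v s.δ s.hist).1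
  δ := (σ s.v s.δ s.hist _ (ρ s.v s.δ s.hist).2).1
  hist := .step s.hist (ρ s.v s.δ s.hist).2 (σ s.v s.δ s.hist _ (ρ s.v s.δ s.hist).2).2

/-- The states met when Runner plays `ρ` and Saboteur plays `σ`. -/
def run (ρ : G.RunnerStrategy) (σ : G.SaboteurStrategy) : ℕ → G.State
  | 0 => ⟨G.vI, G.δI, .start⟩
  | n + 1 => (run ρ σ n).next ρ σ

/-- The unique play defined by a pair of strategies. -/
def outcome (ρ : G.RunnerStrategy) (σ : G.SaboteurStrategy) : G.Play where
  vert n := (run ρ σ n).v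
  dist n := (run ρ σ n).δ
  vert_zero := rfl
  dist_zero := rfl
  edge n := (ρ _ _ (run ρ σ n).hist).2
  redistr n := (σ _ _ (run ρ σ n).hist _ (ρ _ _ (run ρ σ n).hist).2).2

/-- The cost function of the game, lifted to plays. -/
def Play.cost (π : G.Play) : EReal :=
  G.f.eval fun i => ((π.dist i).at ⟨(π.vert i, π.vert (i + 1)), π.edge i⟩ : ℝ)

variable (G)

/-- The superior value of a sabotage game. -/
def superiorValue : EReal :=
  ⨆ σ : G.SaboteurStrategy, ⨅ ρ : G.RunnerStrategy, (outcome ρ σ).cost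

/-- The inferior value of a sabotage game. -/
def inferiorValue : EReal :=
  ⨅ ρ : G.RunnerStrategy, ⨆ σ : G.SaboteurStrategy, (outcome ρ σ).cost

/-! ### Encoding of a sabotage game as a quantitative game -/

/-- Vertices of the encoding: those of `Min` are the pairs of a vertex and a distribution, those
of `Max` the pairs of an edge and a distribution. -/
abbrev EncVertex : Type _ := (V × G.Dist) ⊕ (G.E × G.Dist)

/-- Edges of the encoding. -/
def encEdge : G.EncVertex → G.EncVertex → Prop
  | .inl (v, δ), .inr (e, δ') => e.1.1 = v ∧ δ' = δ
  | .inr (e, δ), .inl (v', δ') => e.1.2 = v' ∧ δ.Redistr δ'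
  | _, _ => False

/-- The weight of an edge of the encoding; the last case does not occur for edges. -/
def encWeight : G.EncVertex → G.EncVertex → ℕ
  | .inl (_, δ), .inr (e, _) => δ.at e
  | .inr (e, δ), .inl _ =>
    match G.f with
    | .DS _ _ _ => 0
    | _ => δ.at e
  | _, _ => 0

/-- The arena of the encoding. -/
def encArena : WeightedArena G.EncVertex where
  owner
    | .inl _ => .Min
    | .inr _ => .Max
  edge := G.encEdge
  weight x y _ := G.encWeight x y
  init := .inl (G.vI, G.δI)
  exists_edge := by
    rintro (⟨v, δ⟩ | ⟨e, δ⟩)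
    · obtain ⟨v', h⟩ := G.no_deadlock v
      exact ⟨.inr (⟨(v, v'), h⟩, δ), rfl, rfl⟩
    · exact ⟨.inl (e.1.2, δ), rfl, e, e, .inl rfl, .inl rfl, fun _ _ _ => rfl⟩

end SabotageGame

/-- The cost function used in the encoding: the factor of a discounted sum is replaced by its
square root. -/
def CostFunction.enc : CostFunction → CostFunction
  | .DS lam h0 h1 => .DS (Real.sqrt lam) (Real.sqrt_pos.2 h0)
      ((Real.sqrt_lt_sqrt h0.le h1).trans_eq Real.sqrt_one)
  | f => f

/-- The value function of the encoding. -/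
def SabotageGame.encValueFunction {V : Type*} (G : SabotageGame V) : G.encArena.Play → EReal :=
  G.encArena.valueFunction G.f.enc

end Sabotage

end

/-!
For a play, all six costs can be compared with a real threshold `c` by means of partial sums of
rewards of its moves, and every game in question is determined at every threshold: either `Min` can
guarantee a cost of at most `c`, or `Max` can guarantee a cost of at least `c`. This gives equality of
the values (`upperValue_eq_lowerValue_of_threshold`).

For `Inf`, `Sup` and `DS`, crossing the threshold means that the partial sums of nonnegative,
possibly time-dependent rewards exceed a constant at some time. This is an open condition, and
`sums_le_or_lt` is the determinacy of open games: a player who cannot force a crossing within any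
fixed number of moves is held off forever, because vertices have finitely many successors.

For `LimInf`, `LimSup` and `Avg`, the question is whether partial sums of a reward stay bounded or
grow. For the limits the reward is the indicator of the edges on the wrong side of `c`, and for
the average it is the weight minus `c`. By `sums_bounded_or_linear`, one player keeps the sums bounded
or the other makes them grow linearly. To see this, consider the finite game on simple paths that
ends when the first cycle is closed, and is won by the one player if the sum along this cycle is at
most `0` and by the other if it is positive. It is determined (`FirstCycleWin` and its complement).
A winner of the finite game plays the infinite one by removing cycles from the history as soon as they
are closed (`Prefix.prune`): all removed cycles are good for the winner, and what remains is a
simple path, which contributes a bounded amount (`exists_strategy_of_stack`).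

For a sabotage game, strategies of the encoding can be consulted on encoded prefixes. Hence the
inferior value is at most the upper value of the encoding, and the superior value is at least its
lower value; the costs agree by `eval_enc`. Since the encoding has equal upper and lower values and the
superior value is at most the inferior value, all four values are equal.
-/

noncomputable section

namespace Sabotage

theorem Player.eq_of_ne {p p' r : Player} (h : p ≠ p') (hr : r ≠ p) : r = p' := by
  cases p <;> cases p' <;> cases r <;> simp_all

namespace WeightedArena

variable {V : Type*} {G : WeightedArena V}

/-! ### Strategies from invariants of histories -/

/-- A property of prefixes that `p` can preserve at its own vertices, and that the other player
cannot destroy, is kept along all outcomes of some strategy of `p`. -/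
theorem exists_strategy_of_invariant (p : Player) (I : ∀ v, G.Prefix v → Prop)
    (h0 : I _ (.start rfl))
    (hp : ∀ v (q : G.Prefix v), I v q → G.owner v = p →
      ∃ v', ∃ h : G.edge v v', I v' (.step q h))
    (hopp : ∀ v (q : G.Prefix v), I v q → G.owner v ≠ p →
      ∀ v' (h : G.edge v v'), I v' (.step q h)) :
    ∃ σ : G.Strategy p, ∀ π ∈ σ.outcomes, ∀ n, I _ (π.take n) := by
  classical
  have key : ∀ v (_ : G.owner v = p) (q : G.Prefix v),
      ∃ s : {v' // G.edge v v'}, I v q → I s.1 (.step q s.2) := by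
    intro v hv q
    by_cases hI : I v q
    · obtain ⟨v', h, h'⟩ := hp v q hI hv
      exact ⟨⟨v', h⟩, fun _ => h'⟩
    · obtain ⟨v', h⟩ := G.exists_edge v
      exact ⟨⟨v', h⟩, fun h => absurd h hI⟩
  choose σ hσ using key
  refine ⟨σ, fun π hπ n => ?_⟩
  induction n with
  | zero =>
    have : ∀ v (h : v = G.init), I v (.start h) := by rintro _ rfl; exact h0
    exact this _ π.vert_zero
  | succ n ih =>
    by_cases ho : G.owner (π.vert n) = p
    · have h1 := hσ _ ho (π.take n) ih
      have h2 := hπ n ho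
      have : ∀ v' (h : G.edge (π.vert n) v'), v' = (σ _ ho (π.take n)).1 →
          I v' (.step (π.take n) h) := by rintro _ h rfl; exact h1
      exact this _ (π.edge n) h2
    · exact hopp _ _ ih ho _ (π.edge n)

/-- The number of moves of a prefix. -/
def Prefix.length : ∀ {v : V}, G.Prefix v → ℕ
  | _, .start _ => 0
  | _, .step q _ => q.length + 1

/-- The sum along a prefix of rewards that depend on the move and on its time. -/
def Prefix.total (x : ℕ → V → V → ℝ) : ∀ {v : V}, G.Prefix v → ℝ
  | _, .start _ => 0
  | _, .step (v := v) (v' := v') q _ => q.total x + x q.length v v'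

theorem Play.length_take (π : G.Play) (n : ℕ) : (π.take n).length = n := by
  induction n with
  | zero => rfl
  | succ n ih => simp [Play.take, Prefix.length, ih]

theorem Play.total_take (x : ℕ → V → V → ℝ) (π : G.Play) (n : ℕ) :
    (π.take n).total x = ∑ i ∈ Finset.range n, x i (π.vert i) (π.vert (i + 1)) := by
  induction n with
  | zero => rfl
  | succ n ih => simp [Play.take, Prefix.total, ih, Finset.sum_range_succ, Play.length_take]

/-! ### Reaching a bound in finitely many moves -/

/-- Player `p` can make sure that `T` holds after exactly `k` further moves. -/
def Forces (p : Player) (T : ∀ v, G.Prefix v → Prop) : ℕ → ∀ v, G.Prefix v → Prop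
  | 0, v, q => T v q
  | k + 1, v, q =>
    (G.owner v = p ∧ ∃ v', ∃ h : G.edge v v', Forces p T k v' (.step q h)) ∨
    (G.owner v ≠ p ∧ ∀ v' (h : G.edge v v'), Forces p T k v' (.step q h))

/-- As every vertex has a successor and `T` is closed under extension, one more move does no harm. -/
theorem Forces.succ {p : Player} {T : ∀ v, G.Prefix v → Prop}
    (hT : ∀ v (q : G.Prefix v), T v q → ∀ v' (h : G.edge v v'), T v' (.step q h)) :
    ∀ (k : ℕ) (v : V) (q : G.Prefix v), Forces p T k v q → Forces p T (k + 1) v q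
  | 0, v, q, h => by
    by_cases ho : G.owner v = p
    · obtain ⟨v', e⟩ := G.exists_edge v
      exact .inl ⟨ho, v', e, hT v q h v' e⟩
    · exact .inr ⟨ho, fun v' e => hT v q h v' e⟩
  | k + 1, v, q, h => by
    rcases h with ⟨ho, v', e, h⟩ | ⟨ho, h⟩
    · exact .inl ⟨ho, v', e, Forces.succ hT k _ _ h⟩
    · exact .inr ⟨ho, fun v' e => Forces.succ hT k _ _ (h v' e)⟩

theorem Forces.mono {p : Player} {T : ∀ v, G.Prefix v → Prop}
    (hT : ∀ v (q : G.Prefix v), T v q → ∀ v' (h : G.edge v v'), T v' (.step q h))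
    {k l : ℕ} (hkl : k ≤ l) {v : V} {q : G.Prefix v} (h : Forces p T k v q) :
    Forces p T l v q := by
  induction hkl with
  | refl => exact h
  | step _ ih => exact Forces.succ hT _ _ _ ih

/-- Determinacy of the open game in which `p'` wants to reach a set `T` of prefixes that is closed
under extension. As the arena is finite, `p'` has a uniform bound on the time needed. -/
theorem avoid_or_reach [Finite V] {p p' : Player} (hpp : p ≠ p') (T : ∀ v, G.Prefix v → Prop)
    (hT : ∀ v (q : G.Prefix v), T v q → ∀ v' (h : G.edge v v'), T v' (.step q h)) :
    (∃ σ : G.Strategy p, ∀ π ∈ σ.outcomes, ∀ n, ¬ T _ (π.take n)) ∨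
    ∃ (N : ℕ) (σ : G.Strategy p'), ∀ π ∈ σ.outcomes, T _ (π.take N) := by
  by_cases h : ∃ k, Forces p' T k _ (.start rfl)
  · obtain ⟨N, hN⟩ := h
    obtain ⟨σ, hσ⟩ := exists_strategy_of_invariant p'
      (fun v q => Forces p' T (N - q.length) v q) hN
      (by
        intro v q hq ho
        rcases Nat.lt_or_ge q.length N with hl | hl
        · obtain ⟨k, hk⟩ := Nat.exists_eq_add_of_lt hl
          rw [show N - q.length = k + 1 by omega] at hq
          rcases hq with ⟨-, v', e, hq⟩ | ⟨ho', -⟩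
          · refine ⟨v', e, ?_⟩
            rwa [show N - (Prefix.step q e).length = k by simp only [Prefix.length]; omega]
          · exact absurd ho ho'
        · obtain ⟨v', e⟩ := G.exists_edge v
          refine ⟨v', e, ?_⟩
          rw [show N - q.length = 0 by omega] at hq
          rw [show N - (Prefix.step q e).length = 0 by simp only [Prefix.length]; omega]
          exact hT _ _ hq _ _)
      (by
        intro v q hq ho v' e
        rcases Nat.lt_or_ge q.length N with hl | hl
        · obtain ⟨k, hk⟩ := Nat.exists_eq_add_of_lt hl
          rw [show N - q.length = k + 1 by omega] at hq
          rcases hq with ⟨ho', -⟩ | ⟨-, hq⟩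
          · exact absurd ho' ho
          · rw [show N - (Prefix.step q e).length = k by simp only [Prefix.length]; omega]
            exact hq v' e
        · rw [show N - q.length = 0 by omega] at hq
          rw [show N - (Prefix.step q e).length = 0 by simp only [Prefix.length]; omega]
          exact hT _ _ hq _ _)
    refine .inr ⟨N, σ, fun π hπ => ?_⟩
    have := hσ π hπ N
    rwa [Play.length_take, Nat.sub_self] at this
  · left
    obtain ⟨σ, hσ⟩ := exists_strategy_of_invariant p
      (fun v q => ¬ ∃ k, Forces p' T k v q) h
      (by
        intro v q hq ho
        by_contra! hcon
        -- finitely many successors, so the times needed after each of them have a common bound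
        have hcon' : ∀ v', ∃ k, ∀ e : G.edge v v', Forces p' T k v' (.step q e) := by
          intro v'
          by_cases e : G.edge v v'
          · obtain ⟨k, hk⟩ := hcon v' e
            exact ⟨k, fun _ => hk⟩
          · exact ⟨0, fun e' => absurd e' e⟩
        choose k hk using hcon'
        obtain ⟨M, hM⟩ := Finite.exists_le k
        exact hq ⟨M + 1, .inr ⟨ho ▸ hpp, fun v' e => Forces.mono hT (hM v') (hk v' e)⟩⟩)
      (by
        rintro v q hq ho v' e ⟨k, hk⟩
        exact hq ⟨k + 1, .inl ⟨Player.eq_of_ne hpp ho, v', e, hk⟩⟩)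
    exact ⟨σ, fun π hπ n hn => hσ π hπ n ⟨0, hn⟩⟩

/-- For nonnegative rewards, exceeding `K` is an open condition on plays; so either `p` keeps all
partial sums at most `K`, or `p'` makes them exceed `K` at a fixed time. -/
theorem sums_le_or_lt [Finite V] {p p' : Player} (hpp : p ≠ p') (x : ℕ → V → V → ℝ)
    (hx : ∀ i v v', 0 ≤ x i v v') (K : ℝ) :
    (∃ σ : G.Strategy p, ∀ π ∈ σ.outcomes, ∀ n,
      ∑ i ∈ Finset.range n, x i (π.vert i) (π.vert (i + 1)) ≤ K) ∨
    ∃ (N : ℕ) (σ : G.Strategy p'), ∀ π ∈ σ.outcomes,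
      K < ∑ i ∈ Finset.range N, x i (π.vert i) (π.vert (i + 1)) := by
  have := avoid_or_reach (G := G) hpp (fun v q => K < q.total x)
    (fun v q h v' e => h.trans_le (le_add_of_nonneg_right (hx _ _ _)))
  simpa only [Play.total_take, not_lt] using this

/-! ### Removing cycles from histories -/

/-- The sum of `y` along the path whose list of vertices, from the last one to the first one, is
given. -/
def pathSum (y : V → V → ℝ) : List V → ℝ
  | a :: b :: l => y b a + pathSum y (b :: l)
  | _ => 0

theorem pathSum_le_length {y : V → V → ℝ} {C : ℝ} (hC : 0 ≤ C) (hy : ∀ v v', y v v' ≤ C) :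
    ∀ l : List V, pathSum y l ≤ l.length * C
  | [] => by simp [pathSum]
  | [a] => by simpa [pathSum] using hC
  | a :: b :: l => by
    have := pathSum_le_length hC hy (b :: l)
    have := hy b a
    simp only [pathSum, List.length_cons] at *
    push_cast at *
    linarith

/-- A path with `l.length + 1` vertices has `l.length` edges. -/
theorem pathSum_const_sub (y : V → V → ℝ) (ε : ℝ) (a : V) (l : List V) :
    pathSum (fun v v' => ε - y v v') (a :: l) = l.length * ε - pathSum y (a :: l) := by
  induction l generalizing a with
  | nil => simp [pathSum]
  | cons b l ih =>
    simp only [pathSum, ih, List.length_cons]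
    push_cast
    ring

/-- Finitely many positive numbers are bounded away from `0`. -/
theorem exists_pos_le {ι : Type*} [Finite ι] (D : ι → ℝ) :
    ∃ η > 0, ∀ i, 0 < D i → η ≤ D i := by
  obtain ⟨M, hM⟩ := Finite.exists_ge
    (fun i => (⟨if 0 < D i then D i else 1, by split_ifs <;> simp_all⟩ : Set.Ioi (0 : ℝ)))
  refine ⟨M, M.2, fun i hi => ?_⟩
  have : (M : ℝ) ≤ if 0 < D i then D i else 1 := hM i
  rwa [if_pos hi] at this

section Stack

variable [DecidableEq V]

/-- The part of a reversed path `s` up to the visit of `v`. -/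
def cut (s : List V) (v : V) : List V := s.dropWhile (· ≠ v)

/-- The reversed simple path that is left of a prefix when every cycle is removed as soon as it is
closed. -/
def Prefix.prune : ∀ {v : V}, G.Prefix v → List V
  | v, .start _ => [v]
  | v, .step q _ => if v ∈ q.prune then cut q.prune v else v :: q.prune

theorem cut_eq_cons {s : List V} {v : V} (h : v ∈ s) : ∃ t, cut s v = v :: t := by
  induction s with
  | nil => simp at h
  | cons a s ih =>
    by_cases ha : a = v
    · exact ⟨s, by simp [cut, ha]⟩
    · obtain ⟨t, ht⟩ := ih ((List.mem_cons.1 h).resolve_left (Ne.symm ha))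
      exact ⟨t, by simpa [cut, ha] using ht⟩

theorem Prefix.prune_eq_cons {v : V} (q : G.Prefix v) : ∃ t, q.prune = v :: t := by
  cases q with
  | start h => exact ⟨[], rfl⟩
  | step q h =>
    by_cases hv : v ∈ q.prune
    · simpa [Prefix.prune, hv] using cut_eq_cons hv
    · exact ⟨q.prune, by simp [Prefix.prune, hv]⟩

theorem Prefix.nodup_prune {v : V} (q : G.Prefix v) : q.prune.Nodup := by
  induction q with
  | start h => simp [Prefix.prune]
  | @step _ v q h ih =>
    by_cases hv : v ∈ q.prune
    · simpa [Prefix.prune, hv, cut] using ih.sublist (List.dropWhile_suffix _).sublist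
    · simpa [Prefix.prune, hv] using ih

/-- Suppose that, on the simple paths in `W`, player `p` can play such that every move either leads
to another simple path in `W` or closes a cycle whose sum is at most `0`. The strategy that plays
like this on the pruned history keeps the sums bounded: removing a cycle never decreases the
potential `pathSum y`, so this potential of the pruned history bounds the sum from above, and a simple
path has boundedly many edges. All nonempty initial segments of the pruned history stay in `W`, since
it may be cut back to any of them. -/
theorem exists_strategy_of_stack [Finite V] (p : Player) (y : V → V → ℝ) (W : List V → Prop)
    (h0 : W [G.init])
    (hp : ∀ v s, (v :: s).Nodup → W (v :: s) → G.owner v = p → ∃ v', G.edge v v' ∧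
      (v' ∈ v :: s → pathSum y (v' :: v :: s) ≤ pathSum y (cut (v :: s) v')) ∧
      (v' ∉ v :: s → W (v' :: v :: s)))
    (hopp : ∀ v s, (v :: s).Nodup → W (v :: s) → G.owner v ≠ p → ∀ v', G.edge v v' →
      (v' ∈ v :: s → pathSum y (v' :: v :: s) ≤ pathSum y (cut (v :: s) v')) ∧
      (v' ∉ v :: s → W (v' :: v :: s))) :
    ∃ (K : ℝ) (σ : G.Strategy p), ∀ π ∈ σ.outcomes, ∀ n,
      ∑ i ∈ Finset.range n, y (π.vert i) (π.vert (i + 1)) ≤ K := by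
  -- one move preserves the invariant, whether it extends the pruned history or closes a cycle
  have hstep : ∀ v (q : G.Prefix v) v' (e : G.edge v v'),
      (q.total (fun _ => y) ≤ pathSum y q.prune ∧ ∀ t, t <:+ q.prune → t ≠ [] → W t) →
      (v' ∈ q.prune → pathSum y (v' :: q.prune) ≤ pathSum y (cut q.prune v')) →
      (v' ∉ q.prune → W (v' :: q.prune)) →
      ((Prefix.step q e).total (fun _ => y) ≤ pathSum y (Prefix.step q e).prune ∧
        ∀ t, t <:+ (Prefix.step q e).prune → t ≠ [] → W t) := by
    intro v q v' e ⟨h1, h2⟩ hc ho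
    have hsum : (Prefix.step q e).total (fun _ => y) ≤ pathSum y (v' :: q.prune) := by
      obtain ⟨s, hs⟩ := q.prune_eq_cons
      rw [hs] at h1 ⊢
      simp only [Prefix.total, pathSum]
      linarith
    by_cases hv : v' ∈ q.prune
    · have hpr : (Prefix.step q e).prune = cut q.prune v' := by simp [Prefix.prune, hv]
      rw [hpr]
      exact ⟨hsum.trans (hc hv), fun t ht => h2 t (ht.trans (List.dropWhile_suffix _))⟩
    · have hpr : (Prefix.step q e).prune = v' :: q.prune := by simp [Prefix.prune, hv]
      rw [hpr]
      refine ⟨hsum, fun t ht hne => ?_⟩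
      rcases List.suffix_cons_iff.1 ht with rfl | ht
      · exact ho hv
      · exact h2 t ht hne
  obtain ⟨σ, hσ⟩ := exists_strategy_of_invariant p
    (fun v q => q.total (fun _ => y) ≤ pathSum y q.prune ∧ ∀ t, t <:+ q.prune → t ≠ [] → W t)
    (by
      refine ⟨by simp [Prefix.total, Prefix.prune, pathSum], fun t ht hne => ?_⟩
      replace ht : t <:+ [G.init] := by simpa [Prefix.prune] using ht
      rcases List.suffix_cons_iff.1 ht with rfl | ht
      · exact h0
      · exact absurd (List.suffix_nil.1 ht) hne)
    (by
      intro v q hq ho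
      obtain ⟨s, hs⟩ := q.prune_eq_cons
      have hW : W (v :: s) := hq.2 _ (by rw [hs]) (by simp)
      obtain ⟨v', e, hc, hn⟩ := hp v s (hs ▸ q.nodup_prune) hW ho
      exact ⟨v', e, hstep v q v' e hq (by rwa [hs]) (by rwa [hs])⟩)
    (by
      intro v q hq ho v' e
      obtain ⟨s, hs⟩ := q.prune_eq_cons
      have hW : W (v :: s) := hq.2 _ (by rw [hs]) (by simp)
      obtain ⟨hc, hn⟩ := hopp v s (hs ▸ q.nodup_prune) hW ho v' e
      exact hstep v q v' e hq (by rwa [hs]) (by rwa [hs]))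
  obtain ⟨C, hC⟩ := Finite.exists_le (fun z : V × V => y z.1 z.2)
  have := Fintype.ofFinite V
  refine ⟨Fintype.card V * max C 0, σ, fun π hπ n => ?_⟩
  rw [← Play.total_take (fun _ => y)]
  refine (hσ π hπ n).1.trans ((pathSum_le_length (le_max_right C 0)
    (fun v v' => (hC (v, v')).trans (le_max_left _ _)) _).trans ?_)
  have := (π.take n).nodup_prune.length_le_card
  gcongr

/-- The simple paths (reversed) from which player `p` can make sure that the first cycle that is
closed has sum at most `0`. For `v' ∈ v :: s` the move to `v'` closes a cycle, whose sum is the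
difference of the path sums of `v' :: v :: s` and of what is left of it after the cut. -/
inductive FirstCycleWin (G : WeightedArena V) (p : Player) (x : V → V → ℝ) : List V → Prop
  | push {v v' : V} {s : List V} (ho : G.owner v = p) (e : G.edge v v') (hv : v' ∉ v :: s)
      (h : FirstCycleWin G p x (v' :: v :: s)) : FirstCycleWin G p x (v :: s)
  | close {v v' : V} {s : List V} (ho : G.owner v = p) (e : G.edge v v') (hv : v' ∈ v :: s)
      (h : pathSum x (v' :: v :: s) ≤ pathSum x (cut (v :: s) v')) : FirstCycleWin G p x (v :: s)
  | opp {v : V} {s : List V} (ho : G.owner v ≠ p)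
      (hc : ∀ v', G.edge v v' → v' ∈ v :: s →
        pathSum x (v' :: v :: s) ≤ pathSum x (cut (v :: s) v'))
      (h : ∀ v', G.edge v v' → v' ∉ v :: s → FirstCycleWin G p x (v' :: v :: s)) :
      FirstCycleWin G p x (v :: s)

/-- Either `p` keeps the sums bounded from above, or `p'` makes them grow linearly. This is decided
by the game that stops at the first cycle: if `p` cannot make its sum at most `0`, then `p'` can make
it positive, hence positive even after a small `ε` has been subtracted on each edge. -/
theorem sums_bounded_or_linear [Finite V] {p p' : Player} (hpp : p ≠ p') (x : V → V → ℝ) :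
    (∃ (K : ℝ) (σ : G.Strategy p), ∀ π ∈ σ.outcomes, ∀ n,
      ∑ i ∈ Finset.range n, x (π.vert i) (π.vert (i + 1)) ≤ K) ∨
    ∃ ε > 0, ∃ (K : ℝ) (σ : G.Strategy p'), ∀ π ∈ σ.outcomes, ∀ n : ℕ,
      ε * n - K ≤ ∑ i ∈ Finset.range n, x (π.vert i) (π.vert (i + 1)) := by
  have := Fintype.ofFinite V
  by_cases h : FirstCycleWin G p x [G.init]
  · left
    refine exists_strategy_of_stack p x (FirstCycleWin G p x) h ?_ ?_
    · intro v s _ hW ho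
      cases hW with
      | push _ e hv h => exact ⟨_, e, fun h' => absurd h' hv, fun _ => h⟩
      | close _ e hv h => exact ⟨_, e, fun _ => h, fun h' => absurd hv h'⟩
      | opp ho' => exact absurd ho ho'
    · intro v s _ hW ho v' e
      cases hW with
      | push ho' => exact absurd ho' ho
      | close ho' => exact absurd ho' ho
      | opp _ hc h => exact ⟨hc v' e, h v' e⟩
  · right
    obtain ⟨η, hη, hmin⟩ := exists_pos_le
      (fun z : {l : List V // l.Nodup} × V =>
        pathSum x (z.2 :: z.1.1) - pathSum x (cut z.1.1 z.2))
    -- the positive sums of cycles are at least `η`;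
    -- a cycle has at most `card V` edges, so this `ε` can be subtracted on each of them
    set ε := η / (Fintype.card V + 1) with hε
    have hε0 : 0 < ε := by positivity
    have hεη : Fintype.card V * ε ≤ η := by
      rw [hε, mul_div_assoc', div_le_iff₀ (by positivity)]
      nlinarith
    have hpos : ∀ v s v', (v :: s).Nodup → v' ∈ v :: s →
        ¬ pathSum x (v' :: v :: s) ≤ pathSum x (cut (v :: s) v') →
        pathSum (fun a b => ε - x a b) (v' :: v :: s) ≤
          pathSum (fun a b => ε - x a b) (cut (v :: s) v') := by
      intro v s v' hnd hv hlt
      have h1 : η ≤ pathSum x (v' :: v :: s) - pathSum x (cut (v :: s) v') :=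
        hmin (⟨v :: s, hnd⟩, v') (by simpa using hlt)
      obtain ⟨t, ht⟩ := cut_eq_cons hv
      have h2 : ((v :: s).length : ℝ) ≤ Fintype.card V := by
        exact_mod_cast hnd.length_le_card
      rw [ht] at h1 ⊢
      rw [pathSum_const_sub, pathSum_const_sub]
      have h3 : (0 : ℝ) ≤ t.length * ε := by positivity
      have h4 := mul_le_mul_of_nonneg_right h2 hε0.le
      linarith
    obtain ⟨K, σ, hσ⟩ := exists_strategy_of_stack p' (fun a b => ε - x a b)
      (fun s => ¬ FirstCycleWin G p x s) h
      (by
        intro v s hnd hW ho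
        by_contra! hcon
        refine hW (.opp (ho ▸ hpp.symm) (fun v' e hv => ?_) (fun v' e hv => ?_))
        · by_contra hle
          exact (hcon v' e fun _ => hpos v s v' hnd hv hle).1 hv
        · by_contra hn
          exact hn (hcon v' e fun h' => absurd h' hv).2)
      (by
        intro v s hnd hW ho v' e
        have ho' : G.owner v = p := Player.eq_of_ne hpp.symm ho
        exact ⟨fun hv => hpos v s v' hnd hv fun hle => hW (.close ho' e hv hle),
          fun hv hw => hW (.push ho' e hv hw)⟩)
    refine ⟨ε, hε0, K, σ, fun π hπ n => ?_⟩
    have := hσ π hπ n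
    rw [Finset.sum_sub_distrib] at this
    simp only [Finset.sum_const, Finset.card_range, nsmul_eq_mul] at this
    linarith

end Stack

end WeightedArena

/-! ### Sums and limits of sequences -/

theorem exists_of_sum_ite_pos {P : ℕ → Prop} [DecidablePred P] {n : ℕ}
    (h : 0 < ∑ i ∈ Finset.range n, if P i then (1 : ℝ) else 0) : ∃ i, P i := by
  by_contra! hP
  simp [hP] at h

theorem not_of_sum_ite_nonpos {P : ℕ → Prop} [DecidablePred P]
    (h : ∀ n, ∑ i ∈ Finset.range n, (if P i then (1 : ℝ) else 0) ≤ 0) (i : ℕ) : ¬ P i := by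
  intro hi
  have h1 := Finset.single_le_sum (f := fun i => if P i then (1 : ℝ) else 0)
    (fun j _ => by positivity) (Finset.self_mem_range_succ i)
  have h2 := h (i + 1)
  simp only [hi, if_true] at h1
  linarith

theorem eventually_not_of_sum_ite_le {P : ℕ → Prop} [DecidablePred P] {K : ℝ}
    (h : ∀ n, ∑ i ∈ Finset.range n, (if P i then (1 : ℝ) else 0) ≤ K) :
    ∀ᶠ i in atTop, ¬ P i := by
  by_contra hP
  have hinf : {i | P i}.Infinite := Nat.frequently_atTop_iff_infinite.1 hP
  obtain ⟨m, hm⟩ := exists_nat_gt K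
  obtain ⟨t, ht, rfl⟩ := hinf.exists_subset_card_eq m
  obtain ⟨n, hn⟩ := t.exists_nat_subset_range
  have h1 : ∑ i ∈ t, (if P i then (1 : ℝ) else 0) = t.card := by
    rw [Finset.sum_congr rfl fun i hi => if_pos (show P i from ht hi)]
    simp
  have h2 := Finset.sum_le_sum_of_subset_of_nonneg hn
    (f := fun i => if P i then (1 : ℝ) else 0) (fun j _ _ => by positivity)
  linarith [h n]

theorem frequently_of_linear_le_sum_ite {P : ℕ → Prop} [DecidablePred P] {ε K : ℝ} (hε : 0 < ε)
    (h : ∀ n : ℕ, ε * n - K ≤ ∑ i ∈ Finset.range n, (if P i then (1 : ℝ) else 0)) :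
    ∃ᶠ i in atTop, P i := by
  by_contra hP
  obtain ⟨m, hm⟩ := eventually_atTop.1 (not_frequently.1 hP)
  have hle : ∀ n, ∑ i ∈ Finset.range n, (if P i then (1 : ℝ) else 0) ≤ m := by
    intro n
    calc ∑ i ∈ Finset.range n, (if P i then (1 : ℝ) else 0)
        ≤ ∑ i ∈ Finset.range n, (if i ∈ Finset.range m then (1 : ℝ) else 0) := by
          refine Finset.sum_le_sum fun i _ => ?_
          by_cases hi : i < m
          · simp only [Finset.mem_range, hi, if_true]; split_ifs <;> norm_num
          · simp [hi, hm i (not_lt.1 hi)]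
      _ ≤ m := by
          rw [Finset.sum_ite_mem, Finset.sum_const, nsmul_eq_mul, mul_one]
          exact_mod_cast (Finset.card_le_card Finset.inter_subset_right).trans_eq (by simp)
  obtain ⟨n, hn⟩ := exists_nat_gt ((m + K) / ε)
  rw [div_lt_iff₀ hε] at hn
  linarith [h n, hle n]

/-- The bound on the averages that follows from a bound `K` on the sums of the deviations from `c`;
note that the average at `n` divides a sum of `n + 1` terms by `n`. -/
theorem tendsto_average_bound (c K : ℝ) :
    Tendsto (fun n : ℕ => (((1 / (n : ℝ)) * (c * (n + 1 : ℕ) + K) : ℝ) : EReal)) atTop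
      (nhds (c : EReal)) := by
  refine (continuous_coe_real_ereal.tendsto c).comp ?_
  have h1 : Tendsto (fun n : ℕ => c + (c + K) * (1 / (n : ℝ))) atTop (nhds (c + (c + K) * 0)) :=
    (tendsto_one_div_atTop_nhds_zero_nat.const_mul _).const_add _
  rw [mul_zero, add_zero] at h1
  refine h1.congr' ?_
  filter_upwards [eventually_gt_atTop 0] with n hn
  have : (n : ℝ) ≠ 0 := by positivity
  push_cast
  field_simp
  ring

theorem eval_avg_le {u : ℕ → ℝ} {c K : ℝ}
    (h : ∀ n, ∑ i ∈ Finset.range n, (u i - c) ≤ K) : CostFunction.Avg.eval u ≤ c := by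
  rw [← (tendsto_average_bound c K).liminf_eq]
  refine liminf_le_liminf (Eventually.of_forall fun n => ?_)
  have := h (n + 1)
  rw [Finset.sum_sub_distrib, Finset.sum_const, Finset.card_range, nsmul_eq_mul] at this
  refine EReal.coe_le_coe_iff.2 (mul_le_mul_of_nonneg_left ?_ (by positivity))
  linarith

theorem le_eval_avg {u : ℕ → ℝ} {c K : ℝ}
    (h : ∀ n, -K ≤ ∑ i ∈ Finset.range n, (u i - c)) : c ≤ CostFunction.Avg.eval u := by
  rw [← (tendsto_average_bound c (-K)).liminf_eq]
  refine liminf_le_liminf (Eventually.of_forall fun n => ?_)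
  have := h (n + 1)
  rw [Finset.sum_sub_distrib, Finset.sum_const, Finset.card_range, nsmul_eq_mul] at this
  refine EReal.coe_le_coe_iff.2 (mul_le_mul_of_nonneg_left ?_ (by positivity))
  linarith

/-- Real sequences whose difference tends to `0` have the same lower limit, even an infinite one. -/
theorem liminf_coe_eq_of_tendsto_sub {u v : ℕ → ℝ}
    (h : Tendsto (fun n => u n - v n) atTop (nhds 0)) :
    liminf (fun n => (u n : EReal)) atTop = liminf (fun n => (v n : EReal)) atTop := by
  have key : ∀ {u v : ℕ → ℝ}, Tendsto (fun n => u n - v n) atTop (nhds 0) →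
      liminf (fun n => (u n : EReal)) atTop ≤ liminf (fun n => (v n : EReal)) atTop := by
    intro u v h
    refine EReal.le_of_forall_lt_iff_le.1 fun z hz => ?_
    obtain ⟨r, hr, hrz⟩ := EReal.lt_iff_exists_real_btwn.1 hz
    have hlt : r < z := EReal.coe_lt_coe_iff.1 hrz
    refine liminf_le_of_frequently_le' ?_
    have h1 := frequently_lt_of_liminf_lt (by isBoundedDefault) hr
    refine (h1.and_eventually (h.eventually (gt_mem_nhds (sub_pos.2 hlt)))).mono ?_
    rintro n ⟨h2, h3⟩
    have := EReal.coe_lt_coe_iff.1 h2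
    exact EReal.coe_le_coe_iff.2 (by linarith)
  refine le_antisymm (key h) (key ?_)
  simpa using h.neg

namespace WeightedArena

variable {V : Type*} {G : WeightedArena V}

/-! ### Weak duality -/

/-- A sequence of prefixes, each extending the one before by a move, comes from a play. -/
theorem exists_play_of_states (S : ℕ → Σ v, G.Prefix v) (h0 : S 0 = ⟨G.init, .start rfl⟩)
    (hS : ∀ n, ∃ v', ∃ e : G.edge (S n).1 v', S (n + 1) = ⟨v', .step (S n).2 e⟩) :
    ∃ π : G.Play, ∀ n, (⟨π.vert n, π.take n⟩ : Σ v, G.Prefix v) = S n := by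
  have hedge : ∀ n, G.edge (S n).1 (S (n + 1)).1 := fun n => by
    obtain ⟨v', e, h⟩ := hS n
    rw [h]
    exact e
  refine ⟨⟨fun n => (S n).1, by rw [h0], hedge⟩, fun n => ?_⟩
  induction n with
  | zero =>
    have : ∀ s : Σ v, G.Prefix v, s = ⟨G.init, .start rfl⟩ → ∀ h : s.1 = G.init,
        (⟨s.1, .start h⟩ : Σ v, G.Prefix v) = s := by rintro _ rfl _; rfl
    exact this _ h0 _
  | succ n ih =>
    have ih' := eq_of_heq (Sigma.mk.inj_iff.1 ih).2
    obtain ⟨v', e, h⟩ := hS n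
    have : ∀ t : Σ v, G.Prefix v, t = ⟨v', .step (S n).2 e⟩ → ∀ e' : G.edge (S n).1 t.1,
        (⟨t.1, .step (S n).2 e'⟩ : Σ v, G.Prefix v) = t := by rintro _ rfl _; rfl
    simp only [Play.take]
    rw [ih']
    exact this _ h _

/-- A pair of strategies has a common outcome. -/
theorem exists_mem_outcomes (σ : G.Strategy .Min) (τ : G.Strategy .Max) :
    ∃ π, π ∈ σ.outcomes ∧ π ∈ τ.outcomes := by
  have hmove : ∀ s : Σ v, G.Prefix v, ∃ v', ∃ _ : G.edge s.1 v',
      (∀ h : G.owner s.1 = .Min, v' = (σ s.1 h s.2).1) ∧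
      (∀ h : G.owner s.1 = .Max, v' = (τ s.1 h s.2).1) := by
    rintro ⟨v, q⟩
    have ho : G.owner v = .Min ∨ G.owner v = .Max := by cases G.owner v <;> simp
    rcases ho with ho | ho
    · exact ⟨_, (σ v ho q).2, fun _ => rfl, fun h => by simp [ho] at h⟩
    · exact ⟨_, (τ v ho q).2, fun h => by simp [ho] at h, fun _ => rfl⟩
  choose m e hσ hτ using hmove
  let S : ℕ → Σ v, G.Prefix v := fun n =>
    Nat.rec ⟨G.init, .start rfl⟩ (fun _ s => ⟨m s, .step s.2 (e s)⟩) n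
  obtain ⟨π, hπ⟩ := exists_play_of_states S rfl fun n => ⟨m (S n), e (S n), rfl⟩
  have hv : ∀ n, π.vert (n + 1) = m ⟨π.vert n, π.take n⟩ := fun n => by
    rw [hπ n]
    exact congrArg Sigma.fst (hπ (n + 1))
  exact ⟨π, fun k h => (hv k).trans (hσ ⟨_, _⟩ h), fun k h => (hv k).trans (hτ ⟨_, _⟩ h)⟩

theorem lowerValue_le_upperValue (f : G.Play → EReal) : G.lowerValue f ≤ G.upperValue f := by
  refine iSup_le fun τ => le_iInf fun σ => ?_
  obtain ⟨π, hσ, hτ⟩ := exists_mem_outcomes σ τ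
  exact (iInf₂_le π hτ).trans (le_iSup₂ (f := fun π (_ : π ∈ σ.outcomes) => f π) π hσ)

/-- To show that the values coincide it suffices that, for each real threshold, one of the players
can stay on its side of the threshold. -/
theorem upperValue_eq_lowerValue_of_threshold {f : G.Play → EReal}
    (h : ∀ c : ℝ, (∃ σ : G.Strategy .Min, ∀ π ∈ σ.outcomes, f π ≤ c) ∨
      ∃ σ : G.Strategy .Max, ∀ π ∈ σ.outcomes, c ≤ f π) :
    G.upperValue f = G.lowerValue f := by
  refine le_antisymm (le_of_not_gt fun hlt => ?_) (lowerValue_le_upperValue f)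
  obtain ⟨c, hc, hc'⟩ := EReal.lt_iff_exists_real_btwn.1 hlt
  rcases h c with ⟨σ, hσ⟩ | ⟨σ, hσ⟩
  · exact hc'.not_ge ((iInf_le _ σ).trans (iSup₂_le hσ))
  · exact hc.not_ge ((le_iInf₂ hσ).trans (le_iSup (fun σ : G.Strategy .Max => σ.valueMax f) σ))

/-! ### Determinacy of the quantitative games -/

open Classical in
/-- The weight of an edge, as a total function: pairs that are not edges get weight `0`. -/
def wt (G : WeightedArena V) (v v' : V) : ℕ := if h : G.edge v v' then G.weight v v' h else 0

theorem valueFunction_eq (f : CostFunction) (π : G.Play) :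
    G.valueFunction f π = f.eval fun i => (G.wt (π.vert i) (π.vert (i + 1)) : ℝ) := by
  simp [valueFunction, wt, π.edge]

theorem upperValue_eq_lowerValue [Finite V] (G : WeightedArena V) (f : CostFunction) :
    G.upperValue (G.valueFunction f) = G.lowerValue (G.valueFunction f) := by
  classical
  refine upperValue_eq_lowerValue_of_threshold fun c => ?_
  simp only [valueFunction_eq]
  have h01 : Player.Min ≠ .Max := by simp
  cases f with
  | Inf =>
    rcases sums_le_or_lt (G := G) h01.symm (fun _ v v' => if (G.wt v v' : ℝ) < c then 1 else 0)
      (fun _ v v' => by positivity) 0 with ⟨σ, hσ⟩ | ⟨N, σ, hσ⟩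
    · refine .inr ⟨σ, fun π hπ => le_iInf fun i => EReal.coe_le_coe_iff.2 ?_⟩
      exact not_lt.1 (not_of_sum_ite_nonpos (hσ π hπ) i)
    · refine .inl ⟨σ, fun π hπ => ?_⟩
      obtain ⟨i, hi⟩ := exists_of_sum_ite_pos (hσ π hπ)
      exact iInf_le_of_le i (EReal.coe_le_coe_iff.2 hi.le)
  | Sup =>
    rcases sums_le_or_lt (G := G) h01 (fun _ v v' => if c < (G.wt v v' : ℝ) then 1 else 0)
      (fun _ v v' => by positivity) 0 with ⟨σ, hσ⟩ | ⟨N, σ, hσ⟩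
    · refine .inl ⟨σ, fun π hπ => iSup_le fun i => EReal.coe_le_coe_iff.2 ?_⟩
      exact not_lt.1 (not_of_sum_ite_nonpos (hσ π hπ) i)
    · refine .inr ⟨σ, fun π hπ => ?_⟩
      obtain ⟨i, hi⟩ := exists_of_sum_ite_pos (hσ π hπ)
      exact le_iSup_of_le i (EReal.coe_le_coe_iff.2 hi.le)
  | LimInf =>
    rcases sums_bounded_or_linear (G := G) h01.symm
      (fun v v' => if (G.wt v v' : ℝ) < c then 1 else 0) with ⟨K, σ, hσ⟩ | ⟨ε, hε, K, σ, hσ⟩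
    · refine .inr ⟨σ, fun π hπ => le_liminf_of_le (by isBoundedDefault) ?_⟩
      exact (eventually_not_of_sum_ite_le (hσ π hπ)).mono
        fun i hi => EReal.coe_le_coe_iff.2 (not_lt.1 hi)
    · refine .inl ⟨σ, fun π hπ => liminf_le_of_frequently_le' ?_⟩
      exact (frequently_of_linear_le_sum_ite hε (hσ π hπ)).mono
        fun i hi => EReal.coe_le_coe_iff.2 hi.le
  | LimSup =>
    rcases sums_bounded_or_linear (G := G) h01
      (fun v v' => if c < (G.wt v v' : ℝ) then 1 else 0) with ⟨K, σ, hσ⟩ | ⟨ε, hε, K, σ, hσ⟩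
    · refine .inl ⟨σ, fun π hπ => limsup_le_of_le (by isBoundedDefault) ?_⟩
      exact (eventually_not_of_sum_ite_le (hσ π hπ)).mono
        fun i hi => EReal.coe_le_coe_iff.2 (not_lt.1 hi)
    · refine .inr ⟨σ, fun π hπ => le_limsup_of_frequently_le' ?_⟩
      exact (frequently_of_linear_le_sum_ite hε (hσ π hπ)).mono
        fun i hi => EReal.coe_le_coe_iff.2 hi.le
  | Avg =>
    rcases sums_bounded_or_linear (G := G) h01
      (fun v v' => (G.wt v v' : ℝ) - c) with ⟨K, σ, hσ⟩ | ⟨ε, hε, K, σ, hσ⟩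
    · exact .inl ⟨σ, fun π hπ => eval_avg_le (hσ π hπ)⟩
    · refine .inr ⟨σ, fun π hπ => le_eval_avg (K := K) fun n => le_trans ?_ (hσ π hπ n)⟩
      have : 0 ≤ ε * n := by positivity
      linarith
  | DS lam pos lt_one =>
    rcases sums_le_or_lt (G := G) h01 (fun i v v' => lam ^ i * (G.wt v v' : ℝ))
      (fun _ v v' => by positivity) c with ⟨σ, hσ⟩ | ⟨N, σ, hσ⟩
    · refine .inl ⟨σ, fun π hπ => EReal.coe_le_coe_iff.2 ?_⟩
      exact Real.tsum_le_of_sum_range_le (fun i => by positivity) (hσ π hπ)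
    · refine .inr ⟨σ, fun π hπ => EReal.coe_le_coe_iff.2 ((hσ π hπ).le.trans ?_)⟩
      refine Summable.sum_le_tsum _ (fun i _ => by positivity) ?_
      obtain ⟨M, hM⟩ := Finite.exists_le (fun z : V × V => G.wt z.1 z.2)
      refine Summable.of_nonneg_of_le (fun i => by positivity) (fun i => ?_)
        ((summable_geometric_of_lt_one pos.le lt_one).mul_right (M : ℝ))
      have : (G.wt (π.vert i) (π.vert (i + 1)) : ℝ) ≤ M := by
        exact_mod_cast hM (π.vert i, π.vert (i + 1))
      gcongr

end WeightedArena

/-! ### Costs of sequences in which every entry is doubled -/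

theorem sum_range_two_mul_div_two (a : ℕ → ℝ) (m : ℕ) :
    ∑ i ∈ Finset.range (2 * m), a (i / 2) = 2 * ∑ i ∈ Finset.range m, a i := by
  induction m with
  | zero => simp
  | succ m ih =>
    rw [show 2 * (m + 1) = 2 * m + 1 + 1 by ring, Finset.sum_range_succ, Finset.sum_range_succ, ih,
      Finset.sum_range_succ, show 2 * m / 2 = m by omega, show (2 * m + 1) / 2 = m by omega]
    ring

/-- Passing from `u` to `n ↦ u (n / 2)` does not change the lower limit, as division by `2` maps
`atTop` to itself. -/
theorem liminf_comp_div_two (u : ℕ → EReal) :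
    liminf (fun n => u (n / 2)) atTop = liminf u atTop := by
  conv_rhs => rw [← map_div_atTop_eq_nat 2 two_pos]
  rfl

theorem limsup_comp_div_two (u : ℕ → EReal) :
    limsup (fun n => u (n / 2)) atTop = limsup u atTop := by
  conv_rhs => rw [← map_div_atTop_eq_nat 2 two_pos]
  rfl

/-- The averages of a bounded sequence and of its doubled version are asymptotically equal. At `n`,
the doubled sequence has consumed the first `n / 2 + 1` entries, the last one once or twice. -/
theorem abs_average_sub_le {a : ℕ → ℝ} {M : ℝ} (h0 : ∀ i, 0 ≤ a i) (hM : ∀ i, a i ≤ M) {n : ℕ}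
    (hn : 2 ≤ n) :
    |1 / (n : ℝ) * ∑ i ∈ Finset.range (n + 1), a (i / 2) -
      1 / ((n / 2 : ℕ) : ℝ) * ∑ i ∈ Finset.range (n / 2 + 1), a i| ≤ 2 * M / n := by
  obtain ⟨m, rfl | rfl⟩ : ∃ m, n = 2 * m ∨ n = 2 * m + 1 := ⟨n / 2, by omega⟩
  · have hm : (0 : ℝ) < m := by exact_mod_cast (show 0 < m by omega)
    rw [show 2 * m / 2 = m by omega, Finset.sum_range_succ, sum_range_two_mul_div_two,
      Finset.sum_range_succ, show 2 * m / 2 = m by omega]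
    have : 1 / ((2 * m : ℕ) : ℝ) * (2 * ∑ i ∈ Finset.range m, a i + a m) -
        1 / (m : ℝ) * (∑ i ∈ Finset.range m, a i + a m) = -(a m / (2 * m : ℕ)) := by
      push_cast
      field_simp
      ring
    rw [this, abs_neg, abs_of_nonneg (div_nonneg (h0 m) (by positivity))]
    gcongr
    linarith [h0 m, hM m]
  · have hm : (0 : ℝ) < m := by exact_mod_cast (show 0 < m by omega)
    have hm1 : (1 : ℝ) ≤ m := by exact_mod_cast (show 1 ≤ m by omega)
    rw [show (2 * m + 1) / 2 = m by omega, show 2 * m + 1 + 1 = 2 * (m + 1) by ring,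
      sum_range_two_mul_div_two]
    set s := ∑ i ∈ Finset.range (m + 1), a i with hs
    have hs0 : 0 ≤ s := Finset.sum_nonneg fun i _ => h0 i
    have hsM : s ≤ (m + 1) * M := by
      refine (Finset.sum_le_card_nsmul _ _ M fun i _ => hM i).trans_eq ?_
      simp
    have hM0 : 0 ≤ M := (h0 0).trans (hM 0)
    have : 1 / ((2 * m + 1 : ℕ) : ℝ) * (2 * s) - 1 / (m : ℝ) * s =
        -(s / m / (2 * m + 1 : ℕ)) := by
      push_cast
      field_simp
      ring
    rw [this, abs_neg, abs_of_nonneg (by positivity)]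
    gcongr
    rw [div_le_iff₀ hm]
    nlinarith

/-- In the encoding every cost occurs twice in a row, except that its second occurrence is `0` for
the discounted sum. -/
theorem eval_enc (f : CostFunction) {a b : ℕ → ℝ} {M : ℝ} (h0 : ∀ i, 0 ≤ a i)
    (hM : ∀ i, a i ≤ M) (heven : ∀ i, b (2 * i) = a i)
    (hodd : ∀ i, b (2 * i + 1) = match f with | .DS _ _ _ => 0 | _ => a i) :
    f.enc.eval b = f.eval a := by
  have hdouble : (∀ i, b (2 * i + 1) = a i) → b = fun n => a (n / 2) := by
    intro h
    funext n
    obtain ⟨m, rfl | rfl⟩ : ∃ m, n = 2 * m ∨ n = 2 * m + 1 := ⟨n / 2, by omega⟩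
    · rw [heven, show 2 * m / 2 = m by omega]
    · rw [h, show (2 * m + 1) / 2 = m by omega]
  have hsurj : Function.Surjective (fun n : ℕ => n / 2) := fun m => ⟨2 * m, by simp⟩
  cases f with
  | Inf => rw [hdouble hodd]; exact hsurj.iInf_comp (fun i => (a i : EReal))
  | Sup => rw [hdouble hodd]; exact hsurj.iSup_comp (fun i => (a i : EReal))
  | LimInf => rw [hdouble hodd]; exact liminf_comp_div_two fun i => (a i : EReal)
  | LimSup => rw [hdouble hodd]; exact limsup_comp_div_two fun i => (a i : EReal)
  | Avg =>
    rw [hdouble hodd]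
    refine (liminf_coe_eq_of_tendsto_sub (squeeze_zero_norm' (a := fun n : ℕ => 2 * M / n) ?_
      (tendsto_const_div_atTop_nhds_zero_nat _))).trans (liminf_comp_div_two fun n : ℕ =>
        ((1 / (n : ℝ) * ∑ i ∈ Finset.range (n + 1), a i : ℝ) : EReal))
    filter_upwards [eventually_ge_atTop 2] with n hn
    exact abs_average_sub_le h0 hM hn
  | DS lam pos lt_one =>
    refine congrArg Real.toEReal (?_ : ∑' i, Real.sqrt lam ^ i * b i = ∑' i, lam ^ i * a i)
    have hinj : Function.Injective (fun i : ℕ => 2 * i) := fun i j h => by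
      simpa using h
    -- the terms with odd index vanish, and those with even index are the terms of the other series
    rw [← hinj.tsum_eq]
    · refine tsum_congr fun i => ?_
      rw [heven, pow_mul, Real.sq_sqrt pos.le]
    · intro n hn
      obtain ⟨m, rfl | rfl⟩ : ∃ m, n = 2 * m ∨ n = 2 * m + 1 := ⟨n / 2, by omega⟩
      · exact ⟨m, rfl⟩
      · simp [hodd] at hn

namespace SabotageGame

variable {V : Type*} {G : SabotageGame V}

/-! ### Sabotage games and their encodings -/

theorem encArena_edge_inl {v v' : V} (h : (v, v') ∈ G.E) (δ : G.Dist) :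
    G.encArena.edge (.inl (v, δ)) (.inr (⟨(v, v'), h⟩, δ)) :=
  ⟨rfl, rfl⟩

theorem encArena_edge_inr {v v' : V} (h : (v, v') ∈ G.E) {δ δ' : G.Dist} (hδ : δ.Redistr δ') :
    G.encArena.edge (.inr (⟨(v, v'), h⟩, δ)) (.inl (v', δ')) :=
  ⟨rfl, hδ⟩

/-- The prefix of the encoding that corresponds to a prefix of the sabotage game: a round consists
of two moves. -/
def encPrefix : ∀ {v : V} {δ : G.Dist}, G.Prefix v δ → G.encArena.Prefix (.inl (v, δ))
  | _, _, .start => .start rfl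
  | _, _, .step (δ := δ) q hv hδ =>
    .step (.step (encPrefix q) (encArena_edge_inl hv δ)) (encArena_edge_inr hv hδ)

/-- The prefix of the encoding after Runner has moved along an edge. -/
def encPrefixEdge {v : V} {δ : G.Dist} (q : G.Prefix v δ) {v' : V} (h : (v, v') ∈ G.E) :
    G.encArena.Prefix (.inr (⟨(v, v'), h⟩, δ)) :=
  .step (encPrefix q) (encArena_edge_inl h δ)

/-- For strategies `ρ`, `σ` of a sabotage game there is a play of the encoding that passes through
the encodings of all prefixes of their outcome. The equalities are between pairs of a vertex and a
prefix ending there, so that no prefix has to be transported along an equality of vertices. -/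
theorem exists_encPlay (ρ : G.RunnerStrategy) (σ : G.SaboteurStrategy) :
    ∃ π : G.encArena.Play, ∀ n,
      ((⟨π.vert (2 * n), π.take (2 * n)⟩ : Σ x, G.encArena.Prefix x) =
        ⟨_, encPrefix (run ρ σ n).hist⟩) ∧
      ((⟨π.vert (2 * n + 1), π.take (2 * n + 1)⟩ : Σ x, G.encArena.Prefix x) =
        ⟨_, encPrefixEdge (run ρ σ n).hist (ρ _ _ (run ρ σ n).hist).2⟩) := by
  let S : ℕ → Σ x, G.encArena.Prefix x := fun n =>
    if n % 2 = 0 then ⟨_, encPrefix (run ρ σ (n / 2)).hist⟩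
      else ⟨_, encPrefixEdge (run ρ σ (n / 2)).hist (ρ _ _ (run ρ σ (n / 2)).hist).2⟩
  have h0 : ∀ n, S (2 * n) = ⟨_, encPrefix (run ρ σ n).hist⟩ := fun n => by
    simp only [S]
    rw [if_pos (by omega), show 2 * n / 2 = n by omega]
  have h1 : ∀ n, S (2 * n + 1) =
      ⟨_, encPrefixEdge (run ρ σ n).hist (ρ _ _ (run ρ σ n).hist).2⟩ := fun n => by
    simp only [S]
    rw [if_neg (by omega), show (2 * n + 1) / 2 = n by omega]
  obtain ⟨π, hπ⟩ := WeightedArena.exists_play_of_states S rfl fun n => by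
    obtain ⟨m, rfl | rfl⟩ : ∃ m, n = 2 * m ∨ n = 2 * m + 1 := ⟨n / 2, by omega⟩
    · rw [h0, h1]
      exact ⟨_, encArena_edge_inl _ _, rfl⟩
    · rw [show 2 * m + 1 + 1 = 2 * (m + 1) by ring, h0, h1]
      exact ⟨_, encArena_edge_inr _ (σ _ _ (run ρ σ m).hist _ (ρ _ _ (run ρ σ m).hist).2).2, rfl⟩
  exact ⟨π, fun n => ⟨(hπ _).trans (h0 n), (hπ _).trans (h1 n)⟩⟩

/-- The play of the encoding that corresponds to the outcome of `ρ` and `σ`. -/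
def encPlay (ρ : G.RunnerStrategy) (σ : G.SaboteurStrategy) : G.encArena.Play :=
  (exists_encPlay ρ σ).choose

theorem encPlay_even (ρ : G.RunnerStrategy) (σ : G.SaboteurStrategy) (n : ℕ) :
    (⟨(encPlay ρ σ).vert (2 * n), (encPlay ρ σ).take (2 * n)⟩ : Σ x, G.encArena.Prefix x) =
      ⟨_, encPrefix (run ρ σ n).hist⟩ :=
  ((exists_encPlay ρ σ).choose_spec n).1

theorem encPlay_odd (ρ : G.RunnerStrategy) (σ : G.SaboteurStrategy) (n : ℕ) :
    (⟨(encPlay ρ σ).vert (2 * n + 1), (encPlay ρ σ).take (2 * n + 1)⟩ :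
        Σ x, G.encArena.Prefix x) =
      ⟨_, encPrefixEdge (run ρ σ n).hist (ρ _ _ (run ρ σ n).hist).2⟩ :=
  ((exists_encPlay ρ σ).choose_spec n).2

theorem vert_encPlay_even (ρ : G.RunnerStrategy) (σ : G.SaboteurStrategy) (n : ℕ) :
    (encPlay ρ σ).vert (2 * n) = .inl ((run ρ σ n).v, (run ρ σ n).δ) :=
  congrArg Sigma.fst (encPlay_even ρ σ n)

theorem vert_encPlay_odd (ρ : G.RunnerStrategy) (σ : G.SaboteurStrategy) (n : ℕ) :
    (encPlay ρ σ).vert (2 * n + 1) =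
      .inr (⟨(_, _), (ρ _ _ (run ρ σ n).hist).2⟩, (run ρ σ n).δ) :=
  congrArg Sigma.fst (encPlay_odd ρ σ n)

theorem encValueFunction_encPlay (ρ : G.RunnerStrategy) (σ : G.SaboteurStrategy) :
    G.encValueFunction (encPlay ρ σ) = (outcome ρ σ).cost := by
  refine eval_enc G.f (M := G.B) (fun i => Nat.cast_nonneg _) (fun i => ?_) (fun i => ?_)
    (fun i => ?_)
  · exact Nat.cast_le.2 (Nat.lt_succ_iff.1 (Fin.is_lt _))
  · change ((G.encWeight _ _ : ℕ) : ℝ) = _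
    rw [vert_encPlay_even, vert_encPlay_odd]
    rfl
  · change ((G.encWeight _ ((encPlay ρ σ).vert (2 * (i + 1))) : ℕ) : ℝ) = _
    rw [vert_encPlay_even, vert_encPlay_odd]
    simp only [encWeight]
    cases G.f <;> first | rfl | exact Nat.cast_zero

/-- Runner imitates a strategy of `Min` by consulting it on the encoded prefix. -/
theorem inferiorValue_le_upperValue_encArena :
    G.inferiorValue ≤ G.encArena.upperValue G.encValueFunction := by
  refine le_iInf fun σ => ?_
  have key : ∀ v δ (q : G.Prefix v δ), ∃ s : {v' // (v, v') ∈ G.E},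
      (σ (.inl (v, δ)) rfl (encPrefix q)).1 = .inr (⟨(v, s.1), s.2⟩, δ) := by
    intro v δ q
    obtain ⟨(⟨v', δ'⟩ | ⟨⟨⟨w, v'⟩, h⟩, δ'⟩), he⟩ := σ (.inl (v, δ)) rfl (encPrefix q)
    · exact he.elim
    · obtain ⟨rfl, rfl⟩ := he
      exact ⟨⟨v', h⟩, rfl⟩
  obtain ⟨ρ, hρ⟩ : ∃ ρ : G.RunnerStrategy, ∀ v δ (q : G.Prefix v δ),
      (σ (.inl (v, δ)) rfl (encPrefix q)).1 = .inr (⟨(v, (ρ v δ q).1), (ρ v δ q).2⟩, δ) :=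
    ⟨fun v δ q => (key v δ q).choose, fun v δ q => (key v δ q).choose_spec⟩
  refine iInf_le_of_le ρ (iSup_le fun τ => ?_)
  rw [← encValueFunction_encPlay]
  refine le_iSup₂ (f := fun π (_ : π ∈ σ.outcomes) => G.encValueFunction π) (encPlay ρ τ) ?_
  intro k hk
  obtain ⟨m, rfl | rfl⟩ : ∃ m, k = 2 * m ∨ k = 2 * m + 1 := ⟨k / 2, by omega⟩
  · refine (vert_encPlay_odd ρ τ m).trans ((hρ _ _ _).symm.trans ?_)
    -- replace the pair of the current vertex and its prefix as a whole
    have : ∀ s : Σ x, G.encArena.Prefix x, s = ⟨_, encPrefix (run ρ τ m).hist⟩ →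
        ∀ h : G.encArena.owner s.1 = .Min,
        (σ (.inl (_, _)) rfl (encPrefix (run ρ τ m).hist)).1 = (σ s.1 h s.2).1 := by
      rintro _ rfl _; rfl
    exact this _ (encPlay_even ρ τ m) hk
  · rw [vert_encPlay_odd] at hk
    cases hk

/-- Saboteur imitates a strategy of `Max` by consulting it on the encoded prefix. -/
theorem lowerValue_encArena_le_superiorValue :
    G.encArena.lowerValue G.encValueFunction ≤ G.superiorValue := by
  refine iSup_le fun τ => ?_
  have key : ∀ v δ (q : G.Prefix v δ) v' (h : (v, v') ∈ G.E), ∃ s : {δ' : G.Dist // δ.Redistr δ'},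
      (τ (.inr (⟨(v, v'), h⟩, δ)) rfl (encPrefixEdge q h)).1 = .inl (v', s.1) := by
    intro v δ q v' h
    obtain ⟨(⟨w, δ'⟩ | ⟨e, δ'⟩), he⟩ := τ (.inr (⟨(v, v'), h⟩, δ)) rfl (encPrefixEdge q h)
    · obtain ⟨rfl, hδ⟩ := he
      exact ⟨⟨δ', hδ⟩, rfl⟩
    · exact he.elim
  obtain ⟨σ, hσ⟩ : ∃ σ : G.SaboteurStrategy, ∀ v δ (q : G.Prefix v δ) v' (h : (v, v') ∈ G.E),
      (τ (.inr (⟨(v, v'), h⟩, δ)) rfl (encPrefixEdge q h)).1 = .inl (v', (σ v δ q v' h).1) :=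
    ⟨fun v δ q v' h => (key v δ q v' h).choose, fun v δ q v' h => (key v δ q v' h).choose_spec⟩
  refine le_iSup_of_le σ (le_iInf fun ρ => ?_)
  rw [← encValueFunction_encPlay]
  refine iInf₂_le (f := fun π (_ : π ∈ τ.outcomes) => G.encValueFunction π) (encPlay ρ σ) ?_
  intro k hk
  obtain ⟨m, rfl | rfl⟩ : ∃ m, k = 2 * m ∨ k = 2 * m + 1 := ⟨k / 2, by omega⟩
  · rw [vert_encPlay_even] at hk
    cases hk
  · refine (vert_encPlay_even ρ σ (m + 1)).trans
      ((hσ _ _ _ _ (ρ _ _ (run ρ σ m).hist).2).symm.trans ?_)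
    -- replace the pair of the current vertex and its prefix as a whole
    have : ∀ s : Σ x, G.encArena.Prefix x,
        s = ⟨_, encPrefixEdge (run ρ σ m).hist (ρ _ _ (run ρ σ m).hist).2⟩ →
        ∀ h : G.encArena.owner s.1 = .Max,
        (τ (.inr (_, _)) rfl
          (encPrefixEdge (run ρ σ m).hist (ρ _ _ (run ρ σ m).hist).2)).1 = (τ s.1 h s.2).1 := by
      rintro _ rfl _; rfl
    exact this _ (encPlay_odd ρ σ m) hk

theorem superiorValue_le_inferiorValue : G.superiorValue ≤ G.inferiorValue :=
  iSup_iInf_le_iInf_iSup _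

end SabotageGame

instance {V : Type*} (E : Finset (V × V)) (B : ℕ) : Finite (Distribution E B) :=
  inferInstanceAs (Finite {δ : E → Fin (B + 1) // ∑ e, (δ e : ℕ) ≤ B})

end Sabotage

end

theorem mainTheorem4 :
    (∀ (V : Type*) [Finite V] (G : Sabotage.WeightedArena V) (f : Sabotage.CostFunction),
      G.upperValue (G.valueFunction f) = G.lowerValue (G.valueFunction f)) ∧
    (∀ (V : Type*) [Finite V] (G : Sabotage.SabotageGame V),
      G.inferiorValue = G.superiorValue ∧
      G.encArena.upperValue G.encValueFunction = G.inferiorValue ∧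
      G.encArena.lowerValue G.encValueFunction = G.superiorValue) := by
  refine ⟨fun V _ G f => Sabotage.WeightedArena.upperValue_eq_lowerValue G f, fun V _ G => ?_⟩
  have h1 := G.inferiorValue_le_upperValue_encArena
  have h2 := G.lowerValue_encArena_le_superiorValue
  have h3 := G.superiorValue_le_inferiorValue
  have h4 : G.encArena.upperValue G.encValueFunction =
      G.encArena.lowerValue G.encValueFunction :=
    Sabotage.WeightedArena.upperValue_eq_lowerValue G.encArena G.f.enc
  have h5 : G.inferiorValue = G.superiorValue := le_antisymm (h1.trans (h4.trans_le h2)) h3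
  exact ⟨h5, le_antisymm (h4.trans_le (h2.trans h3)) h1, le_antisymm h2 (h3.trans (h1.trans_eq h4))⟩
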